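/- An (abstract) operator space is a complex vector space $X$ with norms $\mathcal{O}_n$ on $M_n(X)$, $n\ge 1$, such that $\mathcal{O}_{m+n}(x\oplus y)=\max\{\mathcal{O}_m(x),\mathcal{O}_n(y)\}$ and $\mathcal{O}_n(\alpha x\beta)\le\|\alpha\|\,\mathcal{O}_m(x)\,\|\beta\|$ for all $x\in M_m(X)$, $y\in M_n(X)$, $\alpha\in M_{n,m}(\mathbb{C})$, $\beta\in M_{m,n}(\mathbb{C})$. A numerical radius operator space is a complex vector space $X$ with norms $\mathcal{W}_n$ on $M_n(X)$, $n\ge 1$, such that $\mathcal{W}_{m+n}(x\oplus y)=\max\{\mathcal{W}_m(x),\mathcal{W}_n(y)\}$ and $\mathcal{W}_n(\alpha x\alpha^*)\le\|\alpha\|^2\,\mathcal{W}_m(x)$ for all such $x,y,\alpha$. For a linear map $\varphi:X\to Y$ put $\varphi_n([x_{ij}])=[\varphi(x_{ij})]$. If $X,Y$ are operator spaces, let $$\mathcal{O}(\varphi)_{cb}=\sup_n\,\sup\{\mathcal{O}_n(\varphi_n(x)) : x\in M_n(X),\ \mathcal{O}_n(x)\le 1\}\in[0,\infty];$$ if $X,Y$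 are numerical radius operator spaces, define $\mathcal{W}(\varphi)_{cb}\in[0,\infty]$ in the same way with $\mathcal{W}_n$ in place of $\mathcal{O}_n$. The map $\varphi$ is called completely bounded (respectively $\mathcal{W}$-completely bounded) if this supremum is finite. For an operator space $(X,\mathcal{O}_n)$ and $x\in M_n(X)$ let $$\mathcal{W}_{\max}(x)=\inf\tfrac12\|aa^*+b^*b\|,\qquad \mathcal{W}_{\min}(x)=\tfrac12\mathcal{O}_n(x),$$ the infimum being taken over all $r\in\mathbb{N}$, $a\in M_{n,r}(\mathbb{C})$, $y\in M_r(X)$, $b\in M_{r,n}(\mathbb{C})$ with $x=ayb$ and $\mathcal{O}_r(y)=1$ (and $\mathcal{W}_{\max}=0$ if $X=0$). With these norms $X$ becomes a numerical radius operator space $\mathcal{W}_{\max}(X)$, respectively $\mathcal{W}_{\min}(X)$. Theorem 3.9. Let $X,Y$ be operator spaces and $\varphi:X\to Y$ a linear map. Then 1. $\mathcal{W}(\varphi:\mathcal{W}_{\max}(X)\to\mathcal{W}_{\max}(Y))_{cb}=\mathcal{O}(\varphi:X\to Y)_{cb}$, 2. $\mathcal{W}(\varphi:\mathcal{W}_{\min}(X)\to\mathcal{W}_{\min}(Y))_{cb}=\mathcal{O}(\varphi:X\to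 Y)_{cb}$. Hence, if $\mathbb{O}$ is the category of operator spaces and completely bounded maps and $\mathbb{W}$ the category of numerical radius operator spaces and $\mathcal{W}$-completely bounded maps, then $X\mapsto\mathcal{W}_{\max}(X)$ and $X\mapsto\mathcal{W}_{\min}(X)$, each leaving the underlying linear maps unchanged on morphisms, are functors $\mathbb{O}\to\mathbb{W}$ that are full, faithful and injective on objects. -/

import Mathlib

universe u v

namespace NumRadius

open CategoryTheory
open scoped ENNReal

section Matrices

/-- The `n × n` matrix space over `X`. -/
abbrev Mat (n : ℕ) (X : Type u) : Type u := Matrix (Fin n) (Fin n) X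

/-- The product `α x β` of a matrix `x` over `X` with scalar matrices `α`, `β`. -/
def sandwich {X : Type u} [AddCommGroup X] [Module ℂ X] {n m : ℕ}
    (α : Matrix (Fin n) (Fin m) ℂ) (x : Mat m X) (β : Matrix (Fin m) (Fin n) ℂ) : Mat n X :=
  Matrix.of fun i j => ∑ k, ∑ l, (α i k * β l j) • x k l

/-- The block diagonal matrix with diagonal blocks `x` and `y`. -/
def dsum {X : Type u} [Zero X] {m n : ℕ} (x : Mat m X) (y : Mat n X) : Mat (m + n) X :=
  Matrix.reindex finSumFinEquiv finSumFinEquiv (Matrix.fromBlocks x 0 0 y)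

open scoped Matrix.Norms.L2Operator in
/-- The operator norm of a rectangular complex matrix acting between Hilbert spaces `ℂ^m → ℂ^n`. -/
noncomputable def opNorm {n m : ℕ} (α : Matrix (Fin n) (Fin m) ℂ) : ℝ := ‖α‖

end Matrices

section Structures

/-- A sequence of norms on the matrix spaces over `X`. (At `n = 0` the space is trivial, and so is
its norm.) -/
structure MatrixNorms (X : Type u) [AddCommGroup X] [Module ℂ X] where
  norm : ∀ n : ℕ, Seminorm ℂ (Mat n X)
  eq_zero_of_norm_eq_zero : ∀ (n : ℕ) (x : Mat n X), norm n x = 0 → x = 0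

/-- The structure of an abstract operator space on `X` (Ruan's axioms). -/
structure OperatorSpaceStructure (X : Type u) [AddCommGroup X] [Module ℂ X]
    extends MatrixNorms X where
  norm_dsum : ∀ (m n : ℕ) (x : Mat m X) (y : Mat n X),
    norm (m + n) (dsum x y) = max (norm m x) (norm n y)
  norm_sandwich_le : ∀ (m n : ℕ) (α : Matrix (Fin n) (Fin m) ℂ) (x : Mat m X)
    (β : Matrix (Fin m) (Fin n) ℂ),
    norm n (sandwich α x β) ≤ opNorm α * norm m x * opNorm β

/-- The structure of an abstract numerical radius operator space on `X`. -/
structure NumericalRadiusStructure (X : Type u) [AddCommGroup X] [Module ℂ X]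
    extends MatrixNorms X where
  norm_dsum : ∀ (m n : ℕ) (x : Mat m X) (y : Mat n X),
    norm (m + n) (dsum x y) = max (norm m x) (norm n y)
  norm_conj_le : ∀ (m n : ℕ) (α : Matrix (Fin n) (Fin m) ℂ) (x : Mat m X),
    norm n (sandwich α x α.conjTranspose) ≤ opNorm α ^ 2 * norm m x

variable {X : Type u} [AddCommGroup X] [Module ℂ X]
variable {Y : Type v} [AddCommGroup Y] [Module ℂ Y]

/-- The completely bounded norm, in `[0, ∞]`, of a linear map with respect to given matrix norms:
the supremum over `n` of the norms of the amplifications `φ_n [x_ij] = [φ x_ij]`. -/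
noncomputable def cbNorm (M : MatrixNorms X) (N : MatrixNorms Y) (φ : X →ₗ[ℂ] Y) : ℝ≥0∞ :=
  ⨆ n : ℕ, ⨆ x : Mat n X, ⨆ _ : M.norm n x ≤ 1, ENNReal.ofReal (N.norm n (x.map φ))

/-- The `𝒪`-completely bounded norm of a linear map between operator spaces. -/
noncomputable def OperatorSpaceStructure.cb (OX : OperatorSpaceStructure X)
    (OY : OperatorSpaceStructure Y) (φ : X →ₗ[ℂ] Y) : ℝ≥0∞ :=
  cbNorm OX.toMatrixNorms OY.toMatrixNorms φ

/-- The `𝒲`-completely bounded norm of a linear map between numerical radius operator spaces. -/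
noncomputable def NumericalRadiusStructure.cb (WX : NumericalRadiusStructure X)
    (WY : NumericalRadiusStructure Y) (φ : X →ₗ[ℂ] Y) : ℝ≥0∞ :=
  cbNorm WX.toMatrixNorms WY.toMatrixNorms φ

/-- `𝒲_max (x)` is the infimum of `½ ‖a a* + b* b‖` over all factorizations `x = a y b` with
`𝒪 (y) = 1`. (If `X = 0` there are none, and the value is `sInf ∅ = 0`.) -/
noncomputable def wMaxVal (OX : OperatorSpaceStructure X) (n : ℕ) (x : Mat n X) : ℝ :=
  sInf {t : ℝ | ∃ (r : ℕ) (a : Matrix (Fin n) (Fin r) ℂ) (y : Mat r X)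
    (b : Matrix (Fin r) (Fin n) ℂ), x = sandwich a y b ∧ OX.norm r y = 1 ∧
    t = 1 / 2 * opNorm (a * a.conjTranspose + b.conjTranspose * b)}

end Structures

section Auxiliary

open scoped Matrix.Norms.L2Operator MatrixOrder ComplexOrder

variable {X : Type u} [AddCommGroup X] [Module ℂ X] {Y : Type v} [AddCommGroup Y] [Module ℂ Y]

lemma opNorm_nonneg {n m : ℕ} (α : Matrix (Fin n) (Fin m) ℂ) : 0 ≤ opNorm α := norm_nonneg _

lemma opNorm_mul {n m k : ℕ} (α : Matrix (Fin n) (Fin m) ℂ) (β : Matrix (Fin m) (Fin k) ℂ) :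
    opNorm (α * β) ≤ opNorm α * opNorm β := Matrix.l2_opNorm_mul _ _

lemma opNorm_add {n m : ℕ} (α β : Matrix (Fin n) (Fin m) ℂ) :
    opNorm (α + β) ≤ opNorm α + opNorm β := norm_add_le _ _

lemma opNorm_smul {n m : ℕ} (c : ℂ) (α : Matrix (Fin n) (Fin m) ℂ) :
    opNorm (c • α) = ‖c‖ * opNorm α := norm_smul _ _

lemma opNorm_conjTranspose {n m : ℕ} (α : Matrix (Fin n) (Fin m) ℂ) :
    opNorm α.conjTranspose = opNorm α := Matrix.l2_opNorm_conjTranspose _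

lemma opNorm_mul_conjTranspose {n m : ℕ} (α : Matrix (Fin n) (Fin m) ℂ) :
    opNorm (α * α.conjTranspose) = opNorm α * opNorm α := by
  have := Matrix.l2_opNorm_conjTranspose_mul_self α.conjTranspose
  rw [Matrix.conjTranspose_conjTranspose] at this
  rw [opNorm, this, Matrix.l2_opNorm_conjTranspose]; rfl

lemma opNorm_one_le (n : ℕ) : opNorm (1 : Matrix (Fin n) (Fin n) ℂ) ≤ 1 := by
  rw [opNorm, ← Matrix.diagonal_one, Matrix.l2_opNorm_diagonal]
  exact (pi_norm_le_iff_of_nonneg zero_le_one).2 (by simp)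

lemma opNorm_le_add {n : ℕ} {p q : Matrix (Fin n) (Fin n) ℂ} (hp : p.PosSemidef)
    (hq : q.PosSemidef) : opNorm p ≤ opNorm (p + q) := by
  apply CStarAlgebra.norm_le_norm_of_nonneg_of_le
  · exact Matrix.nonneg_iff_posSemidef.2 hp
  · exact le_add_of_nonneg_right (Matrix.nonneg_iff_posSemidef.2 hq)

lemma opNorm_mul_opNorm_le {n r : ℕ} (a : Matrix (Fin n) (Fin r) ℂ)
    (b : Matrix (Fin r) (Fin n) ℂ) :
    opNorm a * opNorm b ≤ opNorm (a * a.conjTranspose + b.conjTranspose * b) := by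
  have ha : (a * a.conjTranspose).PosSemidef := Matrix.posSemidef_self_mul_conjTranspose a
  have hb : (b.conjTranspose * b).PosSemidef := Matrix.posSemidef_conjTranspose_mul_self b
  have h1 := opNorm_le_add ha hb
  have h2 := opNorm_le_add hb ha
  rw [add_comm] at h2
  rw [opNorm_mul_conjTranspose] at h1
  have h3 := opNorm_mul_conjTranspose b.conjTranspose
  rw [Matrix.conjTranspose_conjTranspose, opNorm_conjTranspose] at h3
  rw [h3] at h2
  nlinarith [sq_nonneg (opNorm a - opNorm b)]

lemma opNorm_dsum_le {m n : ℕ} (p : Matrix (Fin m) (Fin m) ℂ) (q : Matrix (Fin n) (Fin n) ℂ) :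
    opNorm (dsum p q) ≤ max (opNorm p) (opNorm q) := by
  let f : (Matrix (Fin m) (Fin m) ℂ × Matrix (Fin n) (Fin n) ℂ) →⋆ₙₐ[ℂ]
      Matrix (Fin (m + n)) (Fin (m + n)) ℂ :=
    { toFun := fun z => dsum z.1 z.2
      map_smul' := by
        intro c z; ext i j
        refine Fin.addCases (fun i => ?_) (fun i => ?_) i <;>
          refine Fin.addCases (fun j => ?_) (fun j => ?_) j <;> simp [dsum]
      map_zero' := by
        ext i j
        refine Fin.addCases (fun i => ?_) (fun i => ?_) i <;>
          refine Fin.addCases (fun j => ?_) (fun j => ?_) j <;> simp [dsum]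
      map_add' := by
        intro z w; ext i j
        refine Fin.addCases (fun i => ?_) (fun i => ?_) i <;>
          refine Fin.addCases (fun j => ?_) (fun j => ?_) j <;> simp [dsum]
      map_mul' := by
        intro z w; ext i j
        refine Fin.addCases (fun i => ?_) (fun i => ?_) i <;>
          refine Fin.addCases (fun j => ?_) (fun j => ?_) j <;>
          simp [dsum, Matrix.mul_apply, Fin.sum_univ_add]
      map_star' := by
        intro z; ext i j
        refine Fin.addCases (fun i => ?_) (fun i => ?_) i <;>
          refine Fin.addCases (fun j => ?_) (fun j => ?_) j <;>
          simp [dsum, Matrix.star_apply] }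
  exact NonUnitalStarAlgHom.norm_apply_le f (p, q)

lemma sandwich_sandwich {n m k : ℕ} (α : Matrix (Fin n) (Fin m) ℂ) (a : Matrix (Fin m) (Fin k) ℂ)
    (y : Mat k X) (b : Matrix (Fin k) (Fin m) ℂ) (β : Matrix (Fin m) (Fin n) ℂ) :
    sandwich α (sandwich a y b) β = sandwich (α * a) y (b * β) := by
  ext i j
  simp only [sandwich, Matrix.of_apply, Matrix.mul_apply, Finset.smul_sum, smul_smul,
    Finset.sum_mul_sum, Finset.sum_smul]
  calc _ = ∑ p, ∑ k, ∑ l, ∑ q, (α i p * β q j * (a p k * b l q)) • y k l := by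
        refine Finset.sum_congr rfl fun p _ => ?_
        rw [Finset.sum_comm]
        refine Finset.sum_congr rfl fun k _ => ?_
        rw [Finset.sum_comm]
    _ = _ := by
        rw [Finset.sum_comm]
        refine Finset.sum_congr rfl fun k _ => ?_
        rw [Finset.sum_comm]
        refine Finset.sum_congr rfl fun l _ => ?_
        refine Finset.sum_congr rfl fun p _ => ?_
        refine Finset.sum_congr rfl fun q _ => ?_
        congr 1; ring

lemma sandwich_smul_smul {n m : ℕ} (z w : ℂ) (a : Matrix (Fin n) (Fin m) ℂ) (y : Mat m X)
    (b : Matrix (Fin m) (Fin n) ℂ) :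
    sandwich (z • a) y (w • b) = (z * w) • sandwich a y b := by
  ext i j
  simp only [sandwich, Matrix.of_apply, Matrix.smul_apply, Finset.smul_sum, smul_smul, smul_eq_mul]
  refine Finset.sum_congr rfl fun k _ => Finset.sum_congr rfl fun l _ => ?_
  congr 1; ring

lemma sandwich_smul {n m : ℕ} (c : ℂ) (a : Matrix (Fin n) (Fin m) ℂ) (y : Mat m X)
    (b : Matrix (Fin m) (Fin n) ℂ) :
    sandwich a (c • y) b = c • sandwich a y b := by
  ext i j
  simp only [sandwich, Matrix.of_apply, Matrix.smul_apply, Finset.smul_sum, smul_smul]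
  refine Finset.sum_congr rfl fun k _ => Finset.sum_congr rfl fun l _ => ?_
  congr 1; ring

lemma sandwich_one {n : ℕ} (x : Mat n X) : sandwich 1 x 1 = x := by
  ext i j
  simp [sandwich, Matrix.one_apply, Finset.sum_ite_eq]

lemma sandwich_zero_left {n m : ℕ} (y : Mat m X) (b : Matrix (Fin m) (Fin n) ℂ) :
    sandwich (0 : Matrix (Fin n) (Fin m) ℂ) y b = 0 := by
  ext i j; simp [sandwich]

/-- The row `[a₁, a₂]`. -/
def row {n r s : ℕ} (a₁ : Matrix (Fin n) (Fin r) ℂ) (a₂ : Matrix (Fin n) (Fin s) ℂ) :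
    Matrix (Fin n) (Fin (r + s)) ℂ :=
  Matrix.of fun i => Fin.addCases (a₁ i) (a₂ i)

lemma sandwich_row {n r s : ℕ} (a₁ : Matrix (Fin n) (Fin r) ℂ) (a₂ : Matrix (Fin n) (Fin s) ℂ)
    (y₁ : Mat r X) (y₂ : Mat s X)
    (b₁ : Matrix (Fin r) (Fin n) ℂ) (b₂ : Matrix (Fin s) (Fin n) ℂ) :
    sandwich (row a₁ a₂) (dsum y₁ y₂) (row b₁.transpose b₂.transpose).transpose
      = sandwich a₁ y₁ b₁ + sandwich a₂ y₂ b₂ := by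
  ext i j
  simp [sandwich, row, dsum, Fin.sum_univ_add]

lemma row_mul {n r s : ℕ} (a₁ : Matrix (Fin n) (Fin r) ℂ) (a₂ : Matrix (Fin n) (Fin s) ℂ)
    (b₁ : Matrix (Fin r) (Fin n) ℂ) (b₂ : Matrix (Fin s) (Fin n) ℂ) :
    row a₁ a₂ * (row a₁ a₂).conjTranspose
      + ((row b₁.transpose b₂.transpose).transpose).conjTranspose
        * (row b₁.transpose b₂.transpose).transpose
    = (a₁ * a₁.conjTranspose + b₁.conjTranspose * b₁)
      + (a₂ * a₂.conjTranspose + b₂.conjTranspose * b₂) := by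
  ext i j
  simp [row, Matrix.mul_apply, Fin.sum_univ_add]
  ring

/-- A rectangular block diagonal matrix. -/
def rdsum {n m r s : ℕ} (a₁ : Matrix (Fin n) (Fin r) ℂ) (a₂ : Matrix (Fin m) (Fin s) ℂ) :
    Matrix (Fin (n + m)) (Fin (r + s)) ℂ :=
  Matrix.reindex finSumFinEquiv finSumFinEquiv (Matrix.fromBlocks a₁ 0 0 a₂)

lemma sandwich_rdsum {n m r s : ℕ} (a₁ : Matrix (Fin n) (Fin r) ℂ) (a₂ : Matrix (Fin m) (Fin s) ℂ)
    (y₁ : Mat r X) (y₂ : Mat s X)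
    (b₁ : Matrix (Fin r) (Fin n) ℂ) (b₂ : Matrix (Fin s) (Fin m) ℂ) :
    sandwich (rdsum a₁ a₂) (dsum y₁ y₂) (rdsum b₁ b₂)
      = dsum (sandwich a₁ y₁ b₁) (sandwich a₂ y₂ b₂) := by
  ext i j
  refine Fin.addCases (fun i => ?_) (fun i => ?_) i <;>
    refine Fin.addCases (fun j => ?_) (fun j => ?_) j <;>
    simp [sandwich, rdsum, dsum, Fin.sum_univ_add]

lemma rdsum_mul {n m r s : ℕ} (a₁ : Matrix (Fin n) (Fin r) ℂ) (a₂ : Matrix (Fin m) (Fin s) ℂ)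
    (b₁ : Matrix (Fin r) (Fin n) ℂ) (b₂ : Matrix (Fin s) (Fin m) ℂ) :
    rdsum a₁ a₂ * (rdsum a₁ a₂).conjTranspose + (rdsum b₁ b₂).conjTranspose * rdsum b₁ b₂
    = dsum (a₁ * a₁.conjTranspose + b₁.conjTranspose * b₁)
      (a₂ * a₂.conjTranspose + b₂.conjTranspose * b₂) := by
  ext i j
  refine Fin.addCases (fun i => ?_) (fun i => ?_) i <;>
    refine Fin.addCases (fun j => ?_) (fun j => ?_) j <;>
    simp [rdsum, dsum, Matrix.mul_apply]

lemma opNorm_row_one_zero_le (n s : ℕ) :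
    opNorm (row (1 : Matrix (Fin n) (Fin n) ℂ) (0 : Matrix (Fin n) (Fin s) ℂ)) ≤ 1 := by
  have h := opNorm_mul_conjTranspose (row (1 : Matrix (Fin n) (Fin n) ℂ)
    (0 : Matrix (Fin n) (Fin s) ℂ))
  have h2 : row (1 : Matrix (Fin n) (Fin n) ℂ) (0 : Matrix (Fin n) (Fin s) ℂ)
      * (row (1 : Matrix (Fin n) (Fin n) ℂ) (0 : Matrix (Fin n) (Fin s) ℂ)).conjTranspose = 1 := by
    ext i j
    simp [row, Matrix.mul_apply, Fin.sum_univ_add, Matrix.one_apply]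
  rw [h2] at h
  nlinarith [opNorm_one_le n, opNorm_nonneg (row (1 : Matrix (Fin n) (Fin n) ℂ)
    (0 : Matrix (Fin n) (Fin s) ℂ))]

lemma opNorm_row_zero_one_le (n s : ℕ) :
    opNorm (row (0 : Matrix (Fin n) (Fin s) ℂ) (1 : Matrix (Fin n) (Fin n) ℂ)) ≤ 1 := by
  have h := opNorm_mul_conjTranspose (row (0 : Matrix (Fin n) (Fin s) ℂ)
    (1 : Matrix (Fin n) (Fin n) ℂ))
  have h2 : row (0 : Matrix (Fin n) (Fin s) ℂ) (1 : Matrix (Fin n) (Fin n) ℂ)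
      * (row (0 : Matrix (Fin n) (Fin s) ℂ) (1 : Matrix (Fin n) (Fin n) ℂ)).conjTranspose = 1 := by
    ext i j
    simp [row, Matrix.mul_apply, Fin.sum_univ_add, Matrix.one_apply]
  rw [h2] at h
  nlinarith [opNorm_one_le n, opNorm_nonneg (row (0 : Matrix (Fin n) (Fin s) ℂ)
    (1 : Matrix (Fin n) (Fin n) ℂ))]

lemma sandwich_row_one_zero {n s : ℕ} (x : Mat n X) (y : Mat s X) :
    sandwich (row (1 : Matrix (Fin n) (Fin n) ℂ) (0 : Matrix (Fin n) (Fin s) ℂ)) (dsum x y)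
      (row (1 : Matrix (Fin n) (Fin n) ℂ) (0 : Matrix (Fin n) (Fin s) ℂ)).conjTranspose = x := by
  ext i j
  simp [sandwich, row, dsum, Fin.sum_univ_add, Matrix.one_apply]

lemma sandwich_row_zero_one {n s : ℕ} (x : Mat n X) (y : Mat s X) :
    sandwich (row (0 : Matrix (Fin n) (Fin s) ℂ) (1 : Matrix (Fin n) (Fin n) ℂ)) (dsum y x)
      (row (0 : Matrix (Fin n) (Fin s) ℂ) (1 : Matrix (Fin n) (Fin n) ℂ)).conjTranspose = x := by
  ext i j
  simp [sandwich, row, dsum, Fin.sum_univ_add, Matrix.one_apply]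

lemma wMaxVal_le (OX : OperatorSpaceStructure X) {n r : ℕ} (a : Matrix (Fin n) (Fin r) ℂ)
    (y : Mat r X) (b : Matrix (Fin r) (Fin n) ℂ) (hy : OX.norm r y = 1) :
    wMaxVal OX n (sandwich a y b)
      ≤ 1 / 2 * opNorm (a * a.conjTranspose + b.conjTranspose * b) := by
  refine csInf_le ⟨0, ?_⟩ ⟨r, a, y, b, rfl, hy, rfl⟩
  rintro t ⟨r, a, y, b, -, -, rfl⟩
  exact mul_nonneg (by norm_num) (opNorm_nonneg _)

lemma wMaxVal_nonneg (OX : OperatorSpaceStructure X) {n : ℕ} (x : Mat n X) :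
    0 ≤ wMaxVal OX n x := by
  apply Real.sInf_nonneg
  rintro t ⟨r, a, y, b, -, -, rfl⟩
  exact mul_nonneg (by norm_num) (opNorm_nonneg _)

lemma exists_norm_eq_one (OX : OperatorSpaceStructure X) [Nontrivial X] :
    ∃ y : Mat 1 X, OX.norm 1 y = 1 := by
  obtain ⟨x, hx⟩ := exists_ne (0 : X)
  let z : Mat 1 X := Matrix.of fun _ _ => x
  have hz : OX.norm 1 z ≠ 0 := fun h => hx (by
    have := OX.eq_zero_of_norm_eq_zero 1 z h
    simpa [z] using congrFun (congrFun this 0) 0)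
  refine ⟨(((OX.norm 1 z)⁻¹ : ℝ) : ℂ) • z, ?_⟩
  rw [map_smul_eq_mul, Complex.norm_real, Real.norm_of_nonneg (inv_nonneg.2 (apply_nonneg _ _)),
    inv_mul_cancel₀ hz]

lemma exists_factorization (OX : OperatorSpaceStructure X) [Nontrivial X] {n : ℕ} (x : Mat n X)
    {t : ℝ} (ht : wMaxVal OX n x < t) :
    ∃ (r : ℕ) (a : Matrix (Fin n) (Fin r) ℂ) (y : Mat r X) (b : Matrix (Fin r) (Fin n) ℂ),
      x = sandwich a y b ∧ OX.norm r y = 1 ∧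
      1 / 2 * opNorm (a * a.conjTranspose + b.conjTranspose * b) < t := by
  obtain ⟨s, ⟨r, a, y, b, h1, h2, rfl⟩, hs⟩ := exists_lt_of_csInf_lt (by
    by_cases hx : x = 0
    · obtain ⟨y, hy⟩ := exists_norm_eq_one OX
      exact ⟨_, 1, 0, y, 0, by rw [sandwich_zero_left, hx], hy, rfl⟩
    · have hz : OX.norm n x ≠ 0 := fun h => hx (OX.eq_zero_of_norm_eq_zero n x h)
      refine ⟨_, n, ((OX.norm n x : ℝ) : ℂ) • 1, (((OX.norm n x)⁻¹ : ℝ) : ℂ) • x, (1 : ℂ) • 1,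
        ?_, ?_, rfl⟩
      · rw [sandwich_smul_smul, sandwich_smul, sandwich_one, smul_smul, mul_one,
          ← Complex.ofReal_mul, mul_inv_cancel₀ hz, Complex.ofReal_one, one_smul]
      · rw [map_smul_eq_mul, Complex.norm_real,
          Real.norm_of_nonneg (inv_nonneg.2 (apply_nonneg _ _)), inv_mul_cancel₀ hz]) ht
  exact ⟨r, a, y, b, h1, h2, hs⟩

lemma wMaxVal_of_subsingleton (OX : OperatorSpaceStructure X) [Subsingleton X] {n : ℕ}
    (x : Mat n X) : wMaxVal OX n x = 0 := by
  have : ∀ (r : ℕ) (y : Mat r X), OX.norm r y ≠ 1 := fun r y h => by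
    rw [Subsingleton.elim y 0, map_zero] at h; exact zero_ne_one h
  simp [wMaxVal, this]

lemma wMaxVal_zero (OX : OperatorSpaceStructure X) (n : ℕ) : wMaxVal OX n (0 : Mat n X) = 0 := by
  rcases subsingleton_or_nontrivial X with h | h
  · exact wMaxVal_of_subsingleton OX _
  obtain ⟨y, hy⟩ := exists_norm_eq_one OX
  refine le_antisymm ?_ (wMaxVal_nonneg OX _)
  have := wMaxVal_le OX (0 : Matrix (Fin n) (Fin 1) ℂ) y 0 hy
  rw [sandwich_zero_left] at this
  simpa [opNorm] using this

lemma wMaxVal_add_le (OX : OperatorSpaceStructure X) {n : ℕ} (x₁ x₂ : Mat n X) :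
    wMaxVal OX n (x₁ + x₂) ≤ wMaxVal OX n x₁ + wMaxVal OX n x₂ := by
  rcases subsingleton_or_nontrivial X with h | h
  · simp [wMaxVal_of_subsingleton OX]
  refine le_of_forall_pos_le_add fun ε hε => ?_
  obtain ⟨r, a, y, b, hx, hy, h1⟩ := exists_factorization OX x₁ (t := wMaxVal OX n x₁ + ε / 2)
    (by linarith)
  obtain ⟨s, c, z, d, hx', hz, h2⟩ := exists_factorization OX x₂ (t := wMaxVal OX n x₂ + ε / 2)
    (by linarith)
  have h3 := wMaxVal_le OX (row a c) (dsum y z) (row b.transpose d.transpose).transpose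
    (by rw [OX.norm_dsum, hy, hz, max_self])
  rw [sandwich_row, row_mul, ← hx, ← hx'] at h3
  have h4 := opNorm_add (a * a.conjTranspose + b.conjTranspose * b)
    (c * c.conjTranspose + d.conjTranspose * d)
  linarith

lemma wMaxVal_smul_le (OX : OperatorSpaceStructure X) {n : ℕ} (c : ℂ) (x : Mat n X) :
    wMaxVal OX n (c • x) ≤ ‖c‖ * wMaxVal OX n x := by
  rcases subsingleton_or_nontrivial X with h | h
  · simp [wMaxVal_of_subsingleton OX]
  by_cases hc : c = 0
  · simp [hc, wMaxVal_zero]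
  have hc' : 0 < ‖c‖ := norm_pos_iff.2 hc
  rw [← div_le_iff₀' hc']
  refine le_of_forall_gt_imp_ge_of_dense fun t ht => ?_
  obtain ⟨r, a, y, b, rfl, hy, h1⟩ := exists_factorization OX x ht
  rw [div_le_iff₀' hc']
  set s : ℝ := Real.sqrt ‖c‖ with hs
  have hs0 : 0 < s := Real.sqrt_pos.2 hc'
  have hss : s * s = ‖c‖ := Real.mul_self_sqrt hc'.le
  have hsC : (s : ℂ) ≠ 0 := by exact_mod_cast hs0.ne'
  have h2 := wMaxVal_le OX ((c / s) • a) y ((s : ℂ) • b) hy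
  rw [sandwich_smul_smul, div_mul_cancel₀ _ hsC] at h2
  have e1 : (c / s) * star (c / s) = (‖c‖ : ℂ) := by
    rw [Complex.star_def, Complex.mul_conj, Complex.normSq_eq_norm_sq, norm_div,
      Complex.norm_real, Real.norm_of_nonneg hs0.le]
    norm_cast
    rw [div_pow, pow_two s, hss]; field_simp
  have e2 : star (s : ℂ) * s = (‖c‖ : ℂ) := by
    rw [Complex.star_def, Complex.conj_ofReal]; exact_mod_cast hss
  have e : ((c / s) • a) * ((c / s) • a).conjTranspose + ((s : ℂ) • b).conjTranspose * ((s : ℂ) • b)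
      = (‖c‖ : ℂ) • (a * a.conjTranspose + b.conjTranspose * b) := by
    rw [Matrix.conjTranspose_smul, Matrix.conjTranspose_smul, Matrix.smul_mul, Matrix.mul_smul,
      Matrix.smul_mul, Matrix.mul_smul, smul_smul, smul_smul, e1, e2, smul_add]
  rw [e, opNorm_smul] at h2
  simp only [Complex.norm_real, norm_norm] at h2
  nlinarith

lemma norm_le_two_mul_wMaxVal (OX : OperatorSpaceStructure X) {n : ℕ} (x : Mat n X) :
    OX.norm n x ≤ 2 * wMaxVal OX n x := by
  rcases subsingleton_or_nontrivial X with h | h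
  · rw [Subsingleton.elim x 0, wMaxVal_zero]; simp
  rw [← div_le_iff₀' (by norm_num)]
  refine le_of_forall_gt_imp_ge_of_dense fun t ht => ?_
  obtain ⟨r, a, y, b, rfl, hy, h1⟩ := exists_factorization OX x ht
  have h2 := OX.norm_sandwich_le _ _ a y b
  rw [hy, mul_one] at h2
  have h3 := opNorm_mul_opNorm_le a b
  linarith

lemma wMaxVal_conj_le (OX : OperatorSpaceStructure X) {m n : ℕ} (α : Matrix (Fin n) (Fin m) ℂ)
    (x : Mat m X) :
    wMaxVal OX n (sandwich α x α.conjTranspose) ≤ opNorm α ^ 2 * wMaxVal OX m x := by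
  rcases subsingleton_or_nontrivial X with h | h
  · simp [wMaxVal_of_subsingleton OX]
  have key : ∀ t, wMaxVal OX m x < t →
      wMaxVal OX n (sandwich α x α.conjTranspose) ≤ opNorm α ^ 2 * t := by
    intro t ht
    obtain ⟨r, a, y, b, rfl, hy, h1⟩ := exists_factorization OX x ht
    rw [sandwich_sandwich]
    refine (wMaxVal_le OX _ _ _ hy).trans ?_
    have e : α * a * (α * a).conjTranspose
        + (b * α.conjTranspose).conjTranspose * (b * α.conjTranspose)
        = α * (a * a.conjTranspose + b.conjTranspose * b) * α.conjTranspose := by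
      simp [Matrix.conjTranspose_mul, Matrix.mul_assoc, Matrix.mul_add, Matrix.add_mul]
    rw [e]
    have h2 := opNorm_mul (α * (a * a.conjTranspose + b.conjTranspose * b)) α.conjTranspose
    have h3 := opNorm_mul α (a * a.conjTranspose + b.conjTranspose * b)
    rw [opNorm_conjTranspose] at h2
    have h0 := opNorm_nonneg α
    have h4 := mul_le_mul_of_nonneg_right h3 h0
    have h5 := mul_le_mul_of_nonneg_left h1.le (sq_nonneg (opNorm α))
    nlinarith
  refine le_of_forall_pos_le_add fun ε hε => ?_
  have hpos : 0 < opNorm α ^ 2 + 1 := by positivity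
  have h1 := key (wMaxVal OX m x + ε / (opNorm α ^ 2 + 1)) (by
    have : 0 < ε / (opNorm α ^ 2 + 1) := by positivity
    linarith)
  have h2 : opNorm α ^ 2 * (ε / (opNorm α ^ 2 + 1)) ≤ ε := by
    rw [mul_div_assoc', div_le_iff₀ hpos]; nlinarith
  linarith

lemma wMaxVal_dsum (OX : OperatorSpaceStructure X) {m n : ℕ} (x : Mat m X) (y : Mat n X) :
    wMaxVal OX (m + n) (dsum x y) = max (wMaxVal OX m x) (wMaxVal OX n y) := by
  rcases subsingleton_or_nontrivial X with h | h
  · simp [wMaxVal_of_subsingleton OX]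
  apply le_antisymm
  · refine le_of_forall_gt_imp_ge_of_dense fun t ht => ?_
    obtain ⟨r, a, z, b, rfl, hz, h1⟩ := exists_factorization OX x (lt_of_le_of_lt (le_max_left _ _) ht)
    obtain ⟨s, c, w, d, rfl, hw, h2⟩ := exists_factorization OX y (lt_of_le_of_lt (le_max_right _ _) ht)
    have h3 := wMaxVal_le OX (rdsum a c) (dsum z w) (rdsum b d)
      (by rw [OX.norm_dsum, hz, hw, max_self])
    rw [sandwich_rdsum, rdsum_mul] at h3
    have h4 := opNorm_dsum_le (a * a.conjTranspose + b.conjTranspose * b)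
      (c * c.conjTranspose + d.conjTranspose * d)
    rcases le_max_iff.1 h4 with h5 | h5 <;> linarith
  · have aux : ∀ {k : ℕ} (α : Matrix (Fin k) (Fin (m + n)) ℂ), opNorm α ≤ 1 →
        wMaxVal OX k (sandwich α (dsum x y) α.conjTranspose) ≤ wMaxVal OX (m + n) (dsum x y) := by
      intro k α hα
      refine (wMaxVal_conj_le OX α _).trans ?_
      have h0 := opNorm_nonneg α
      exact mul_le_of_le_one_left (wMaxVal_nonneg OX _) (pow_le_one₀ h0 hα)
    apply max_le
    · have := aux _ (opNorm_row_one_zero_le m n)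
      rwa [sandwich_row_one_zero] at this
    · have := aux _ (opNorm_row_zero_one_le n m)
      rwa [sandwich_row_zero_one] at this

lemma MatrixNorms.norm_map_le (M : MatrixNorms X) (N : MatrixNorms Y) (φ : X →ₗ[ℂ] Y) {n : ℕ}
    (x : Mat n X) :
    ENNReal.ofReal (N.norm n (x.map φ)) ≤ cbNorm M N φ * ENNReal.ofReal (M.norm n x) := by
  by_cases hx : x = 0
  · subst hx
    have : (0 : Mat n X).map φ = 0 := by ext; simp
    simp [this]
  have hz : M.norm n x ≠ 0 := fun h => hx (M.eq_zero_of_norm_eq_zero n x h)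
  have hpos : 0 < M.norm n x := lt_of_le_of_ne (apply_nonneg _ _) hz.symm
  set c : ℂ := (((M.norm n x)⁻¹ : ℝ) : ℂ) with hc
  have hcn : ‖c‖ = (M.norm n x)⁻¹ := by
    rw [hc, Complex.norm_real, Real.norm_of_nonneg (inv_nonneg.2 hpos.le)]
  have h1 : M.norm n (c • x) ≤ 1 := by
    rw [map_smul_eq_mul, hcn, inv_mul_cancel₀ hz]
  have h2 : ENNReal.ofReal (N.norm n ((c • x).map φ)) ≤ cbNorm M N φ :=
    le_iSup_of_le n (le_iSup_of_le (c • x) (le_iSup_of_le h1 le_rfl))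
  have h3 : (c • x).map φ = c • x.map φ := by ext; simp
  rw [h3, map_smul_eq_mul, hcn] at h2
  calc ENNReal.ofReal (N.norm n (x.map φ))
      = ENNReal.ofReal ((M.norm n x)⁻¹ * N.norm n (x.map φ)) * ENNReal.ofReal (M.norm n x) := by
        rw [← ENNReal.ofReal_mul (mul_nonneg (inv_nonneg.2 hpos.le) (apply_nonneg _ _))]
        congr 1; field_simp
    _ ≤ _ := by gcongr

end Auxiliary

section WMaxMin

variable {X : Type u} [AddCommGroup X] [Module ℂ X]

/-- The maximal numerical radius norm `𝒲_max` affiliated with an operator space. -/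
noncomputable def wMax (OX : OperatorSpaceStructure X) : NumericalRadiusStructure X where
  norm n := Seminorm.ofSMulLE (wMaxVal OX n) (wMaxVal_zero OX n) (wMaxVal_add_le OX)
    (wMaxVal_smul_le OX)
  eq_zero_of_norm_eq_zero n x h := by
    have h' : wMaxVal OX n x = 0 := h
    have := norm_le_two_mul_wMaxVal OX x
    rw [h', mul_zero] at this
    exact OX.eq_zero_of_norm_eq_zero n x (le_antisymm this (apply_nonneg _ _))
  norm_dsum _ _ x y := wMaxVal_dsum OX x y
  norm_conj_le _ _ α x := wMaxVal_conj_le OX α x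

/-- The minimal numerical radius norm `𝒲_min = ½ 𝒪` affiliated with an operator space. -/
noncomputable def wMin (OX : OperatorSpaceStructure X) : NumericalRadiusStructure X where
  norm n := (1 / 2 : NNReal) • OX.norm n
  eq_zero_of_norm_eq_zero n x h := by
    apply OX.eq_zero_of_norm_eq_zero n x
    simpa [smul_apply, NNReal.smul_def] using h
  norm_dsum m n x y := by
    simp only [smul_apply, OX.norm_dsum, NNReal.smul_def, smul_eq_mul]
    exact mul_max_of_nonneg _ _ (NNReal.coe_nonneg _)
  norm_conj_le m n α x := by
    have := OX.norm_sandwich_le m n α x α.conjTranspose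
    rw [opNorm_conjTranspose] at this
    simp only [smul_apply, NNReal.smul_def, smul_eq_mul]
    have h := mul_le_mul_of_nonneg_left this (NNReal.coe_nonneg (1 / 2))
    nlinarith

end WMaxMin

section Categories

/-- A linear map which is completely bounded for the given matrix norms. -/
@[ext]
structure CBMap {X : Type u} [AddCommGroup X] [Module ℂ X] {Y : Type v} [AddCommGroup Y]
    [Module ℂ Y] (M : MatrixNorms X) (N : MatrixNorms Y) where
  toLin : X →ₗ[ℂ] Y
  cb_lt_top : cbNorm M N toLin < ⊤

variable {X : Type u} [AddCommGroup X] [Module ℂ X] {Y : Type u} [AddCommGroup Y] [Module ℂ Y]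
  {Z : Type u} [AddCommGroup Z] [Module ℂ Z]

/-- The identity map, which is completely bounded. -/
def CBMap.id (M : MatrixNorms X) : CBMap M M where
  toLin := LinearMap.id
  cb_lt_top := by
    refine lt_of_le_of_lt (b := 1) ?_ ENNReal.one_lt_top
    refine iSup_le fun n => iSup_le fun x => iSup_le fun hx => ?_
    have : x.map (LinearMap.id : X →ₗ[ℂ] X) = x := by ext; simp
    rw [this]
    simpa using hx

/-- The composition of completely bounded maps. -/
def CBMap.comp {M : MatrixNorms X} {N : MatrixNorms Y} {P : MatrixNorms Z}
    (g : CBMap N P) (f : CBMap M N) : CBMap M P where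
  toLin := g.toLin.comp f.toLin
  cb_lt_top := by
    refine lt_of_le_of_lt (b := cbNorm N P g.toLin * cbNorm M N f.toLin) ?_
      (ENNReal.mul_lt_top g.cb_lt_top f.cb_lt_top)
    refine iSup_le fun n => iSup_le fun x => iSup_le fun hx => ?_
    have : x.map (g.toLin.comp f.toLin) = (x.map f.toLin).map g.toLin := by ext; simp
    rw [this]
    refine (MatrixNorms.norm_map_le N P g.toLin _).trans ?_
    gcongr
    exact le_iSup_of_le n (le_iSup_of_le x (le_iSup_of_le hx le_rfl))

/-- Objects of the category `𝕆`: operator spaces. -/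
structure OpSpace : Type (u + 1) where
  carrier : Type u
  [addCommGroup : AddCommGroup carrier]
  [module : Module ℂ carrier]
  str : OperatorSpaceStructure carrier

attribute [instance] OpSpace.addCommGroup OpSpace.module

/-- Objects of the category `𝕎`: numerical radius operator spaces. -/
structure NRSpace : Type (u + 1) where
  carrier : Type u
  [addCommGroup : AddCommGroup carrier]
  [module : Module ℂ carrier]
  str : NumericalRadiusStructure carrier

attribute [instance] NRSpace.addCommGroup NRSpace.module

/-- The category `𝕆`, whose morphisms are the completely bounded maps. -/
instance : Category.{u} OpSpace.{u} where
  Hom X Y := CBMap X.str.toMatrixNorms Y.str.toMatrixNorms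
  id X := CBMap.id X.str.toMatrixNorms
  comp f g := CBMap.comp g f

/-- The category `𝕎`, whose morphisms are the `𝒲`-completely bounded maps. -/
instance : Category.{u} NRSpace.{u} where
  Hom X Y := CBMap X.str.toMatrixNorms Y.str.toMatrixNorms
  id X := CBMap.id X.str.toMatrixNorms
  comp f g := CBMap.comp g f

/-- The functor from `𝕆` to complex vector spaces that forgets the matrix norms. -/
def OpSpace.toModuleCat : OpSpace.{u} ⥤ ModuleCat.{u} ℂ where
  obj X := ModuleCat.of ℂ X.carrier
  map f := ModuleCat.ofHom (CBMap.toLin f)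

/-- The functor from `𝕎` to complex vector spaces that forgets the matrix norms. -/
def NRSpace.toModuleCat : NRSpace.{u} ⥤ ModuleCat.{u} ℂ where
  obj X := ModuleCat.of ℂ X.carrier
  map f := ModuleCat.ofHom (CBMap.toLin f)

/-- The numerical radius operator space `𝒲_max (X)`. -/
noncomputable def OpSpace.wMax (X : OpSpace.{u}) : NRSpace.{u} where
  carrier := X.carrier
  str := NumRadius.wMax X.str

/-- The numerical radius operator space `𝒲_min (X)`. -/
noncomputable def OpSpace.wMin (X : OpSpace.{u}) : NRSpace.{u} where
  carrier := X.carrier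
  str := NumRadius.wMin X.str

end Categories

end NumRadius

open CategoryTheory NumRadius

namespace NumRadius

/-! ### Homogeneous form of the completely bounded norm, and sandwiches -/

section CompletelyBoundedNorms

variable {X : Type u} [AddCommGroup X] [Module ℂ X] {Y : Type v} [AddCommGroup Y] [Module ℂ Y]

/-! The `𝒲_max` norms determine the operator space norms: placing `x` in the upper right corner of a
matrix of twice the size gives `𝒲_max (corner x) = ½ 𝒪 (x)` (`wMaxVal_corner`). Always `𝒪 ≤ 2
𝒲_max`, and on a corner equality holds, because the two coordinate embeddings used in its
factorization have complementary ranges, so that `a a* + b* b = 1`.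

For part 1, amplifications of `φ` commute with corners, so the bound for `𝒲_max` at a corner is the
bound for `𝒪` at its entry, up to a factor ½ on both sides. Conversely a factorization `x = a y b`
is carried by `φ` to `φ x = a (φ y) b` with the same `a` and `b`, and `𝒪 (φ y) ≤ ‖φ‖_cb`; passing to
the infimum bounds `𝒲_max (φ x)`. In part 2 the factor ½ simply cancels.

By these equalities the same linear maps are morphisms in both categories, which makes both functors
full and faithful. They are injective on objects because `𝒪` is recovered from `𝒲_max` on corners
and from `𝒲_min` by doubling. -/

/-- Together with `MatrixNorms.norm_map_le` this trades the supremum over unit balls for a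
homogeneous inequality, so that no later argument has to normalize `x`. -/
lemma cbNorm_le {M : MatrixNorms X} {N : MatrixNorms Y} {φ : X →ₗ[ℂ] Y} {c : ENNReal}
    (h : ∀ (n : ℕ) (x : Mat n X),
      ENNReal.ofReal (N.norm n (x.map φ)) ≤ c * ENNReal.ofReal (M.norm n x)) :
    cbNorm M N φ ≤ c := by
  refine iSup_le fun n => iSup_le fun x => iSup_le fun hx => (h n x).trans ?_
  exact mul_le_of_le_one_right' (ENNReal.ofReal_le_one.2 hx)

lemma sandwich_map (φ : X →ₗ[ℂ] Y) {n m : ℕ} (a : Matrix (Fin n) (Fin m) ℂ) (x : Mat m X)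
    (b : Matrix (Fin m) (Fin n) ℂ) : (sandwich a x b).map φ = sandwich a (x.map φ) b := by
  ext i j
  simp [sandwich]

lemma sandwich_zero {n m : ℕ} (a : Matrix (Fin n) (Fin m) ℂ) (b : Matrix (Fin m) (Fin n) ℂ) :
    sandwich a (0 : Mat m X) b = 0 := by
  ext i j
  simp [sandwich]

lemma wMax_norm (OX : OperatorSpaceStructure X) (n : ℕ) (x : Mat n X) :
    (wMax OX).norm n x = wMaxVal OX n x := rfl

lemma wMin_norm (OX : OperatorSpaceStructure X) (n : ℕ) (x : Mat n X) :
    (wMin OX).norm n x = 1 / 2 * OX.norm n x := by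
  simp [wMin, NNReal.smul_def]

/-- Normalizing the middle factor removes the condition `𝒪 (y) = 1` from `wMaxVal_le`. This is
needed for `φ y`, whose norm is only bounded and may vanish; the zero matrix cannot be normalized
and is treated apart. -/
lemma wMaxVal_sandwich_le (OX : OperatorSpaceStructure X) {n r : ℕ}
    (a : Matrix (Fin n) (Fin r) ℂ) (y : Mat r X) (b : Matrix (Fin r) (Fin n) ℂ) :
    wMaxVal OX n (sandwich a y b)
      ≤ 1 / 2 * opNorm (a * a.conjTranspose + b.conjTranspose * b) * OX.norm r y := by
  by_cases hy : y = 0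
  · simp [hy, sandwich_zero, wMaxVal_zero]
  have hz : OX.norm r y ≠ 0 := fun h => hy (OX.eq_zero_of_norm_eq_zero r y h)
  have hnn : 0 ≤ OX.norm r y := apply_nonneg _ _
  have h1 : y = ((OX.norm r y : ℝ) : ℂ) • ((((OX.norm r y)⁻¹ : ℝ) : ℂ) • y) := by
    rw [smul_smul, ← Complex.ofReal_mul, mul_inv_cancel₀ hz, Complex.ofReal_one, one_smul]
  have h2 : OX.norm r ((((OX.norm r y)⁻¹ : ℝ) : ℂ) • y) = 1 := by
    rw [map_smul_eq_mul, Complex.norm_real, Real.norm_of_nonneg (inv_nonneg.2 hnn),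
      inv_mul_cancel₀ hz]
  calc wMaxVal OX n (sandwich a y b)
      = wMaxVal OX n (((OX.norm r y : ℝ) : ℂ) •
          sandwich a ((((OX.norm r y)⁻¹ : ℝ) : ℂ) • y) b) := by rw [← sandwich_smul, ← h1]
    _ ≤ OX.norm r y * wMaxVal OX n (sandwich a ((((OX.norm r y)⁻¹ : ℝ) : ℂ) • y) b) := by
        refine (wMaxVal_smul_le OX _ _).trans_eq ?_
        rw [Complex.norm_real, Real.norm_of_nonneg hnn]
    _ ≤ OX.norm r y * (1 / 2 * opNorm (a * a.conjTranspose + b.conjTranspose * b)) :=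
        mul_le_mul_of_nonneg_left (wMaxVal_le OX a _ b h2) hnn
    _ = _ := mul_comm _ _

/-! ### Corners, where `𝒲_max` is half of `𝒪` -/

lemma row_one_zero_mul_conjTranspose (n s : ℕ) :
    row (1 : Matrix (Fin n) (Fin n) ℂ) (0 : Matrix (Fin n) (Fin s) ℂ)
      * (row (1 : Matrix (Fin n) (Fin n) ℂ) (0 : Matrix (Fin n) (Fin s) ℂ)).conjTranspose = 1 := by
  ext i j
  simp [row, Matrix.mul_apply, Fin.sum_univ_add, Matrix.one_apply]

lemma row_zero_one_mul_conjTranspose (n s : ℕ) :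
    row (0 : Matrix (Fin n) (Fin s) ℂ) (1 : Matrix (Fin n) (Fin n) ℂ)
      * (row (0 : Matrix (Fin n) (Fin s) ℂ) (1 : Matrix (Fin n) (Fin n) ℂ)).conjTranspose = 1 := by
  ext i j
  simp [row, Matrix.mul_apply, Fin.sum_univ_add, Matrix.one_apply]

/-- The two summands are the projections onto complementary blocks of coordinates. This is the `a a*
+ b* b` of the factorization defining `corner`. -/
lemma conjTranspose_mul_row_add_eq_one (n s : ℕ) :
    (row (1 : Matrix (Fin n) (Fin n) ℂ) (0 : Matrix (Fin n) (Fin s) ℂ)).conjTranspose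
      * row (1 : Matrix (Fin n) (Fin n) ℂ) (0 : Matrix (Fin n) (Fin s) ℂ)
      + (row (0 : Matrix (Fin s) (Fin n) ℂ) (1 : Matrix (Fin s) (Fin s) ℂ)).conjTranspose
        * row (0 : Matrix (Fin s) (Fin n) ℂ) (1 : Matrix (Fin s) (Fin s) ℂ) = 1 := by
  ext i j
  refine Fin.addCases (fun i => ?_) (fun i => ?_) i <;>
    refine Fin.addCases (fun j => ?_) (fun j => ?_) j <;>
    simp [row, Matrix.mul_apply, Matrix.one_apply] <;>
    simp [Fin.ext_iff, eq_comm] <;> omega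

/-- The block matrix with upper right corner `x` and zeros elsewhere. -/
def corner {n : ℕ} (x : Mat n X) : Mat (n + n) X :=
  sandwich (row (1 : Matrix (Fin n) (Fin n) ℂ) (0 : Matrix (Fin n) (Fin n) ℂ)).conjTranspose x
    (row (0 : Matrix (Fin n) (Fin n) ℂ) (1 : Matrix (Fin n) (Fin n) ℂ))

lemma corner_map (φ : X →ₗ[ℂ] Y) {n : ℕ} (x : Mat n X) :
    (corner x).map φ = corner (x.map φ) := sandwich_map φ _ _ _

/-- Compressing by two different contractions, one on each side, extracts the corner entry. This
uses the two-sided axiom of `𝒪`; the axiom for `𝒲` only allows `α x α*`. -/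
lemma norm_le_norm_corner (OX : OperatorSpaceStructure X) {n : ℕ} (x : Mat n X) :
    OX.norm n x ≤ OX.norm (n + n) (corner x) := by
  set u := row (1 : Matrix (Fin n) (Fin n) ℂ) (0 : Matrix (Fin n) (Fin n) ℂ) with hu
  set v := row (0 : Matrix (Fin n) (Fin n) ℂ) (1 : Matrix (Fin n) (Fin n) ℂ) with hv
  have hx : sandwich u (corner x) v.conjTranspose = x := by
    rw [corner, sandwich_sandwich, hu, hv, row_one_zero_mul_conjTranspose,
      row_zero_one_mul_conjTranspose, sandwich_one]
  have h := OX.norm_sandwich_le _ _ u (corner x) v.conjTranspose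
  rw [hx, opNorm_conjTranspose] at h
  have h0 : 0 ≤ OX.norm (n + n) (corner x) := apply_nonneg _ _
  calc OX.norm n x ≤ opNorm u * OX.norm (n + n) (corner x) * opNorm v := h
    _ ≤ 1 * OX.norm (n + n) (corner x) * 1 := by
        gcongr
        · exact opNorm_nonneg v
        · exact opNorm_row_one_zero_le n n
        · exact opNorm_row_zero_one_le n n
    _ = _ := by ring

/-- The defining factorization of the corner gives the upper bound; the general estimate `𝒪 ≤ 2
𝒲_max` gives the lower one. -/
lemma wMaxVal_corner (OX : OperatorSpaceStructure X) {n : ℕ} (x : Mat n X) :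
    wMaxVal OX (n + n) (corner x) = 1 / 2 * OX.norm n x := by
  apply le_antisymm
  · refine (wMaxVal_sandwich_le OX _ _ _).trans ?_
    refine mul_le_mul_of_nonneg_right ?_ (apply_nonneg _ _)
    rw [Matrix.conjTranspose_conjTranspose, conjTranspose_mul_row_add_eq_one]
    linarith [opNorm_one_le (n + n)]
  · have h1 := norm_le_norm_corner OX x
    have h2 := norm_le_two_mul_wMaxVal OX (corner x)
    linarith

/-! ### Equality of the completely bounded norms -/

theorem wMax_cb (OX : OperatorSpaceStructure X) (OY : OperatorSpaceStructure Y)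
    (φ : X →ₗ[ℂ] Y) : (wMax OX).cb (wMax OY) φ = OX.cb OY φ := by
  apply le_antisymm
  · by_cases hc : OX.cb OY φ = ⊤
    · rw [hc]
      exact le_top
    obtain ⟨c, hc'⟩ := show ∃ c : NNReal, (c : ENNReal) = _ from
      ⟨_, ENNReal.coe_toNNReal hc⟩
    have hle : ∀ (r : ℕ) (y : Mat r X), OY.norm r (y.map φ) ≤ c * OX.norm r y := by
      intro r y
      have h := MatrixNorms.norm_map_le OX.toMatrixNorms OY.toMatrixNorms φ y
      change _ ≤ OX.cb OY φ * _ at h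
      rwa [← hc', ← ENNReal.ofReal_coe_nnreal, ← ENNReal.ofReal_mul c.coe_nonneg,
        ENNReal.ofReal_le_ofReal_iff (mul_nonneg c.coe_nonneg (apply_nonneg _ _))] at h
    refine cbNorm_le fun n x => ?_
    rw [← hc', ← ENNReal.ofReal_coe_nnreal, ← ENNReal.ofReal_mul c.coe_nonneg]
    apply ENNReal.ofReal_le_ofReal
    rw [wMax_norm, wMax_norm]
    -- The zero space has no element of norm 1, hence no admissible factorization to transport.
    rcases subsingleton_or_nontrivial X with hX | hX
    · have : x.map φ = 0 := by
        ext i j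
        simp [Subsingleton.elim (x i j) 0]
      rw [this, wMaxVal_zero]
      exact mul_nonneg c.coe_nonneg (wMaxVal_nonneg OX x)
    -- The infimum need not be attained, so a factorization is chosen below each `t` above it and
    -- pushed through `φ`.
    have key : ∀ t, wMaxVal OX n x < t → wMaxVal OY n (x.map φ) ≤ c * t := by
      intro t ht
      obtain ⟨r, a, y, b, rfl, hy, hlt⟩ := exists_factorization OX x ht
      rw [sandwich_map]
      have h1 := hle r y
      rw [hy, mul_one] at h1
      calc _ ≤ _ := wMaxVal_sandwich_le OY a (y.map φ) b
        _ ≤ t * c := mul_le_mul hlt.le h1 (apply_nonneg _ _)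
            ((wMaxVal_nonneg OX _).trans ht.le)
        _ = c * t := mul_comm _ _
    -- Now `t` tends to the infimum from above; `Real.exp ε` serves as a positive quantity that
    -- tends to 0 as `ε` tends to `-∞`.
    refine ge_of_tendsto' (f := fun ε : ℝ => (c : ℝ) * (wMaxVal OX n x + Real.exp ε))
      (x := Filter.atBot) ?_ fun ε => key _ (by linarith [Real.exp_pos ε])
    simpa using (Real.tendsto_exp_atBot.const_add (wMaxVal OX n x)).const_mul (c : ℝ)
  · refine cbNorm_le fun n x => ?_
    -- Tested on corners, the bound for `𝒲_max` is the bound for `𝒪` with ½ on both sides.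
    have h := MatrixNorms.norm_map_le (wMax OX).toMatrixNorms (wMax OY).toMatrixNorms φ (corner x)
    rw [corner_map, wMax_norm, wMax_norm, wMaxVal_corner, wMaxVal_corner,
      ENNReal.ofReal_mul (by norm_num), ENNReal.ofReal_mul (by norm_num), mul_left_comm] at h
    exact (ENNReal.mul_le_mul_iff_right (by simp) ENNReal.ofReal_ne_top).1 h

theorem wMin_cb (OX : OperatorSpaceStructure X) (OY : OperatorSpaceStructure Y)
    (φ : X →ₗ[ℂ] Y) : (wMin OX).cb (wMin OY) φ = OX.cb OY φ := by
  -- Cancelling ½ is legitimate in `[0, ∞]` because it is neither 0 nor infinite; `c` itself may be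
  -- infinite.
  have half : ∀ (p q : ℝ) (c : ENNReal),
      ENNReal.ofReal (1 / 2 * p) ≤ c * ENNReal.ofReal (1 / 2 * q) ↔
        ENNReal.ofReal p ≤ c * ENNReal.ofReal q := by
    intro p q c
    rw [ENNReal.ofReal_mul (by norm_num), ENNReal.ofReal_mul (by norm_num), mul_left_comm]
    exact ENNReal.mul_le_mul_iff_right (by simp) ENNReal.ofReal_ne_top
  apply le_antisymm
  · refine cbNorm_le fun n x => ?_
    rw [wMin_norm, wMin_norm, half]
    exact MatrixNorms.norm_map_le OX.toMatrixNorms OY.toMatrixNorms φ x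
  · refine cbNorm_le fun n x => ?_
    rw [← half, ← wMin_norm, ← wMin_norm]
    exact MatrixNorms.norm_map_le (wMin OX).toMatrixNorms (wMin OY).toMatrixNorms φ x

/-! ### Recovering the operator space structure -/

lemma OperatorSpaceStructure.ext_norm {O₁ O₂ : OperatorSpaceStructure X}
    (h : ∀ (n : ℕ) (x : Mat n X), O₁.norm n x = O₂.norm n x) : O₁ = O₂ := by
  obtain ⟨⟨N₁, _⟩, _, _⟩ := O₁
  obtain ⟨⟨N₂, _⟩, _, _⟩ := O₂
  obtain rfl : N₁ = N₂ := funext fun n => Seminorm.ext (h n)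
  rfl

/-- The values of `𝒲_max` on corners already determine `𝒪`. -/
lemma wMax_injective : Function.Injective (wMax (X := X)) := by
  intro O₁ O₂ h
  refine OperatorSpaceStructure.ext_norm fun n x => ?_
  have h1 : (wMax O₁).norm (n + n) (corner x) = (wMax O₂).norm (n + n) (corner x) := by rw [h]
  rw [wMax_norm, wMax_norm, wMaxVal_corner, wMaxVal_corner] at h1
  linarith

lemma wMin_injective : Function.Injective (wMin (X := X)) := by
  intro O₁ O₂ h
  refine OperatorSpaceStructure.ext_norm fun n x => ?_
  have h1 : (wMin O₁).norm n x = (wMin O₂).norm n x := by rw [h]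
  rw [wMin_norm, wMin_norm] at h1
  linarith

end CompletelyBoundedNorms

/-! ### The functors `𝒲_max` and `𝒲_min` -/

section Functors

lemma OpSpace.wMax_injective : Function.Injective OpSpace.wMax.{u} := by
  rintro @⟨X, _, _, O₁⟩ @⟨Y, _, _, O₂⟩ h
  -- Equal objects have equal carriers, and then equal additive and scalar structures; once these
  -- are identified, injectivity on a fixed vector space applies.
  obtain ⟨rfl, h₁, h₂, h₃⟩ := NRSpace.mk.inj h
  obtain rfl := eq_of_heq h₁
  obtain rfl := eq_of_heq h₂
  obtain rfl := NumRadius.wMax_injective (eq_of_heq h₃)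
  rfl

lemma OpSpace.wMin_injective : Function.Injective OpSpace.wMin.{u} := by
  rintro @⟨X, _, _, O₁⟩ @⟨Y, _, _, O₂⟩ h
  obtain ⟨rfl, h₁, h₂, h₃⟩ := NRSpace.mk.inj h
  obtain rfl := eq_of_heq h₁
  obtain rfl := eq_of_heq h₂
  obtain rfl := NumRadius.wMin_injective (eq_of_heq h₃)
  rfl

/-- The functor `𝒲_max`, which leaves the underlying linear maps unchanged. -/
noncomputable def wMaxFunctor : OpSpace.{u} ⥤ NRSpace.{u} where
  obj X := X.wMax
  map {X Y} f := CBMap.mk (CBMap.toLin f) ((wMax_cb X.str Y.str _).trans_lt (CBMap.cb_lt_top f))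

/-- The functor `𝒲_min`, which leaves the underlying linear maps unchanged. -/
noncomputable def wMinFunctor : OpSpace.{u} ⥤ NRSpace.{u} where
  obj X := X.wMin
  map {X Y} f := CBMap.mk (CBMap.toLin f) ((wMin_cb X.str Y.str _).trans_lt (CBMap.cb_lt_top f))

/-- The equality of norms, read backwards, makes the linear map underlying any `𝒲`-completely
bounded map completely bounded, so it is its own preimage. -/
instance : wMaxFunctor.{u}.Full where
  map_surjective {X Y} g :=
    ⟨CBMap.mk (CBMap.toLin g) ((wMax_cb X.str Y.str _).symm.trans_lt (CBMap.cb_lt_top g)), rfl⟩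

instance : wMinFunctor.{u}.Full where
  map_surjective {X Y} g :=
    ⟨CBMap.mk (CBMap.toLin g) ((wMin_cb X.str Y.str _).symm.trans_lt (CBMap.cb_lt_top g)), rfl⟩

instance : wMaxFunctor.{u}.Faithful where
  map_injective {X Y} _ _ h := CBMap.ext (congrArg
    (CBMap.toLin (M := X.wMax.str.toMatrixNorms) (N := Y.wMax.str.toMatrixNorms)) h)

instance : wMinFunctor.{u}.Faithful where
  map_injective {X Y} _ _ h := CBMap.ext (congrArg
    (CBMap.toLin (M := X.wMin.str.toMatrixNorms) (N := Y.wMin.str.toMatrixNorms)) h)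

end Functors

end NumRadius

theorem theorem3p9 :
    (∀ (X : Type u) [AddCommGroup X] [Module ℂ X] (Y : Type v) [AddCommGroup Y] [Module ℂ Y]
      (OX : OperatorSpaceStructure X) (OY : OperatorSpaceStructure Y) (φ : X →ₗ[ℂ] Y),
      (wMax OX).cb (wMax OY) φ = OX.cb OY φ ∧ (wMin OX).cb (wMin OY) φ = OX.cb OY φ) ∧
    (∃ F : OpSpace.{u} ⥤ NRSpace.{u},
      (∀ X : OpSpace.{u}, F.obj X = X.wMax) ∧
      F ⋙ NRSpace.toModuleCat = OpSpace.toModuleCat ∧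
      F.Full ∧ F.Faithful ∧ Function.Injective F.obj) ∧
    (∃ F : OpSpace.{u} ⥤ NRSpace.{u},
      (∀ X : OpSpace.{u}, F.obj X = X.wMin) ∧
      F ⋙ NRSpace.toModuleCat = OpSpace.toModuleCat ∧
      F.Full ∧ F.Faithful ∧ Function.Injective F.obj) := by
  refine ⟨fun X _ _ Y _ _ OX OY φ => ⟨wMax_cb OX OY φ, wMin_cb OX OY φ⟩,
    -- Compatibility with the forgetful functors holds by definition, since only the matrix norms
    -- change.
    ⟨wMaxFunctor, fun _ => rfl, rfl, inferInstance, inferInstance, OpSpace.wMax_injective⟩,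
    ⟨wMinFunctor, fun _ => rfl, rfl, inferInstance, inferInstance, OpSpace.wMin_injective⟩⟩
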